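/- Let $\mathcal A$ be an abelian category and let $\operatorname{Ext}^n_{\mathcal A}$ denote the Yoneda Ext groups. For a class $\mathcal C$ of objects put $\mathcal C^{\perp}=\{Y:\operatorname{Ext}^1_{\mathcal A}(C,Y)=0\ \forall C\in\mathcal C\}$ and ${}^{\perp}\mathcal C=\{X:\operatorname{Ext}^1_{\mathcal A}(X,C)=0\ \forall C\in\mathcal C\}$. A pair $(\mathcal X,\mathcal Y)$ with $\mathcal Y=\mathcal X^\perp$, $\mathcal X={}^\perp\mathcal Y$ is a cotorsion pair; it is complete if each object $A$ fits into short exact sequences $0\to Y\to X\to A\to 0$ and $0\to A\to Y'\to X'\to 0$ with $X,X'\in\mathcal X$ and $Y,Y'\in\mathcal Y$, and hereditary if $\operatorname{Ext}^i_{\mathcal A}(X,Y)=0$ for all $X\in\mathcal X$, $Y\in\mathcal Y$, $i\ge 1$. Let $\mathfrak M=(\mathcal Q,\mathcal W,\mathcal R)$ be a hereditary abelian model structure on $\mathcal A$: $\mathcal W$ has the 2-out-of-3 property on short exact sequences, and $(\mathcal Q,\mathcal W\cap\mathcal R)$ and $(\mathcal Q\cap\mathcal W,\mathcal R)$ are complete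 hereditary cotorsion pairs. Objects of $\mathcal Q$, $\mathcal W$, $\mathcal R$ are called cofibrant, trivial, fibrant. Two parallel morphisms are homotopic if their difference factors through an object of $\omega=\mathcal Q\cap\mathcal W\cap\mathcal R$, and $\underline{\operatorname{Hom}}_\omega(X,Y)$ is the group of homotopy classes. The homotopy category $\operatorname{Ho}(\mathfrak M)$ has the objects of $\mathcal A$ and $\operatorname{Ho}(\mathfrak M)(A,B)=\underline{\operatorname{Hom}}_\omega(RQA,RQB)$, where $RQA$ is a chosen bifibrant replacement of $A$; $\gamma:\mathcal A\to\operatorname{Ho}(\mathfrak M)$ is the canonical functor, $\gamma(f)=[R(Q(f))]$. For objects $A,B$ choose short exact sequences $$0\to K\to QA\xrightarrow{p} A\to 0,\qquad 0\to QA\to W\to \Sigma QA\to 0,$$ $$0\to B\xrightarrow{j} RB\to L\to 0,\qquad 0\to \Omega RB\to W'\to RB\to 0$$ with $QA\in\mathcal Q$, $K\in\mathcal W\cap\mathcal R$, $RB\in\mathcal R$, $L\in\mathcal Q\cap\mathcal W$, $W,W'\in\mathcal W$, $\Sigma QA$ cofibrant and $\Omega RB$ fibrant. Such sequences exist; $W$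 can be taken fibrant and $W'$ cofibrant. Then, for all $A$ and $B$ and all such choices, there are isomorphisms of abelian groups $$\operatorname{Ext}^1_{\mathcal A}(\Sigma QA,RB)\;\cong\;\operatorname{Ho}(\mathfrak M)(A,B)\;\cong\;\operatorname{Ext}^1_{\mathcal A}(QA,\Omega RB),$$ natural in $A$ and $B$ in the following sense. Whenever $f:QA\to QA'$ represents $\alpha\in\operatorname{Ho}(\mathfrak M)(A,A')$, i.e. $\gamma(p')\gamma(f)=\alpha\gamma(p)$ (for instance $\alpha=\gamma(a)$, $p'f=ap$), and $h:\Sigma QA\to\Sigma QA'$ is induced from $f$ by a morphism of the chosen short exact sequences, the isomorphisms carry $h^*$ on the left group and $f^*$ on the right group to precomposition with $\alpha$. Dually, whenever $t:RB\to RB'$ represents $\beta\in\operatorname{Ho}(\mathfrak M)(B,B')$, i.e. $\gamma(t)\gamma(j)=\gamma(j')\beta$, and $h:\Omega RB\to\Omega RB'$ is induced from $t$ by a morphism of the chosen short exact sequences, they carry $t_*$ on the left group and $h_*$ on the right group to postcomposition with $\beta$. Moreover, every morphism $a:A\to A'$ of $\mathcal A$ lifts to a morphism $QA\to QA'$ that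 induces some $\Sigma QA\to\Sigma QA'$ as above if the middle term of the suspension sequence of $QA'$ is fibrant; and every $b:B\to B'$ extends to a morphism $RB\to RB'$ that induces some $\Omega RB\to\Omega RB'$ as above if the middle term of the loop sequence of $RB$ is cofibrant. -/

import Mathlib

open CategoryTheory CategoryTheory.Limits CategoryTheory.Abelian
open scoped ZeroObject

universe w v u

namespace HoveyModel

section Orthogonality

variable {C : Type u} [Category.{v} C] [Abelian C] [HasExt.{w} C]

/-- `𝒳^⊥`: the objects `Y` with `Ext¹(X, Y) = 0` for all `X ∈ 𝒳`. -/
def rightPerp (P : ObjectProperty C) : ObjectProperty C :=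
  fun Y => ∀ X, P X → Subsingleton (Ext X Y 1)

/-- `^⊥𝒴`: the objects `X` with `Ext¹(X, Y) = 0` for all `Y ∈ 𝒴`. -/
def leftPerp (P : ObjectProperty C) : ObjectProperty C :=
  fun X => ∀ Y, P Y → Subsingleton (Ext X Y 1)

/-- `(𝒳, 𝒴)` is a cotorsion pair: `𝒴 = 𝒳^⊥` and `𝒳 = ^⊥𝒴`. -/
structure IsCotorsionPair (P R : ObjectProperty C) : Prop where
  right_eq : R = rightPerp P
  left_eq : P = leftPerp R

/-- Enough projectives: each `A` admits `0 ⟶ Y ⟶ X ⟶ A ⟶ 0` with `X ∈ 𝒳`, `Y ∈ 𝒴`. -/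
def EnoughProj (P R : ObjectProperty C) : Prop :=
  ∀ A : C, ∃ (Y X : C) (i : Y ⟶ X) (p : X ⟶ A) (h : i ≫ p = 0),
    (ShortComplex.mk i p h).ShortExact ∧ P X ∧ R Y

/-- Enough injectives: each `A` admits `0 ⟶ A ⟶ Y ⟶ X ⟶ 0` with `Y ∈ 𝒴`, `X ∈ 𝒳`. -/
def EnoughInj (P R : ObjectProperty C) : Prop :=
  ∀ A : C, ∃ (Y X : C) (j : A ⟶ Y) (q : Y ⟶ X) (h : j ≫ q = 0),
    (ShortComplex.mk j q h).ShortExact ∧ R Y ∧ P X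

/-- A complete cotorsion pair. -/
structure IsCompleteCotorsionPair (P R : ObjectProperty C) : Prop
    extends IsCotorsionPair P R where
  enoughProj : EnoughProj P R
  enoughInj : EnoughInj P R

/-- The vanishing of all `Extⁱ(X, Y)`, `i ≥ 1`, for `X ∈ 𝒳` and `Y ∈ 𝒴`. -/
def HereditaryPair (P R : ObjectProperty C) : Prop :=
  ∀ X Y, P X → R Y → ∀ i : ℕ, 1 ≤ i → Subsingleton (Ext X Y i)

/-- The 2-out-of-3 property on short exact sequences. -/
structure IsThick (W : ObjectProperty C) : Prop where
  mem₁ : ∀ S : ShortComplex C, S.ShortExact → W S.X₂ → W S.X₃ → W S.X₁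
  mem₂ : ∀ S : ShortComplex C, S.ShortExact → W S.X₁ → W S.X₃ → W S.X₂
  mem₃ : ∀ S : ShortComplex C, S.ShortExact → W S.X₁ → W S.X₂ → W S.X₃

end Orthogonality

/-- An abelian model structure `(𝒬, 𝒲, ℛ)` on an abelian category: the classes of cofibrant,
trivial and fibrant objects. -/
structure AbelianModelStructure (C : Type u) [Category.{v} C] [Abelian C] [HasExt.{w} C] where
  /-- the cofibrant objects -/
  cof : ObjectProperty C
  /-- the trivial objects -/
  triv : ObjectProperty C
  /-- the fibrant objects -/
  fib : ObjectProperty C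
  thick : IsThick triv
  left_pair : IsCompleteCotorsionPair cof (triv ⊓ fib)
  right_pair : IsCompleteCotorsionPair (cof ⊓ triv) fib

section Ext

variable {C : Type u} [Category.{v} C] [Abelian C] [HasExt.{w} C]

lemma lift_of_ext {X Y A T : C} {i : Y ⟶ X} {p : X ⟶ A} {h : i ≫ p = 0}
    (hS : (ShortComplex.mk i p h).ShortExact) [Subsingleton (Ext T Y 1)] (f : T ⟶ A) :
    ∃ g : T ⟶ X, g ≫ p = f := by
  obtain ⟨x, hx⟩ := Ext.covariant_sequence_exact₃ T hS (Ext.mk₀ f) (zero_add 1)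
    (Subsingleton.elim (α := Ext T Y 1) _ _)
  obtain ⟨g, rfl⟩ := (Ext.mk₀_bijective T X).2 x
  refine ⟨g, (Ext.mk₀_bijective T A).1 ?_⟩
  simpa using hx

lemma desc_of_ext {A Y X T : C} {j : A ⟶ Y} {q : Y ⟶ X} {h : j ≫ q = 0}
    (hS : (ShortComplex.mk j q h).ShortExact) [Subsingleton (Ext X T 1)] (f : A ⟶ T) :
    ∃ g : Y ⟶ T, j ≫ g = f := by
  obtain ⟨x, hx⟩ := Ext.contravariant_sequence_exact₁ hS T (Ext.mk₀ f) (add_zero 1)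
    (Subsingleton.elim (α := Ext X T 1) _ _)
  obtain ⟨g, rfl⟩ := (Ext.mk₀_bijective Y T).2 x
  refine ⟨g, (Ext.mk₀_bijective A T).1 ?_⟩
  simpa using hx

lemma rightPerp_ext {P : ObjectProperty C} {S : ShortComplex C} (hS : S.ShortExact)
    (h₁ : rightPerp P S.X₁) (h₃ : rightPerp P S.X₃) : rightPerp P S.X₂ := by
  intro X hX
  have := h₁ X hX
  have := h₃ X hX
  refine subsingleton_of_forall_eq 0 fun e => ?_
  obtain ⟨x, rfl⟩ := Ext.covariant_sequence_exact₂ X hS e (Subsingleton.elim _ _)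
  rw [Subsingleton.elim x 0, Ext.zero_comp]

lemma leftPerp_ext {P : ObjectProperty C} {S : ShortComplex C} (hS : S.ShortExact)
    (h₁ : leftPerp P S.X₁) (h₃ : leftPerp P S.X₃) : leftPerp P S.X₂ := by
  intro Y hY
  have := h₁ Y hY
  have := h₃ Y hY
  refine subsingleton_of_forall_eq 0 fun e => ?_
  obtain ⟨x, rfl⟩ := Ext.contravariant_sequence_exact₂ hS Y e (Subsingleton.elim _ _)
  rw [Subsingleton.elim x 0, Ext.comp_zero]

lemma leftPerp_zero (P : ObjectProperty C) : leftPerp P (0 : C) := fun Y _ =>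
  subsingleton_of_forall_eq 0 fun e => by
    rw [← Ext.mk₀_id_comp e, show 𝟙 (0 : C) = 0 from Subsingleton.elim _ _, Ext.mk₀_zero,
      Ext.zero_comp]

lemma rightPerp_zero (P : ObjectProperty C) : rightPerp P (0 : C) := fun Y _ =>
  subsingleton_of_forall_eq 0 fun e => by
    rw [← Ext.comp_mk₀_id e, show 𝟙 (0 : C) = 0 from Subsingleton.elim _ _, Ext.mk₀_zero,
      Ext.comp_zero]

lemma biprod_shortExact (X Y : C) :
    (ShortComplex.mk (biprod.inl : X ⟶ X ⊞ Y) biprod.snd (by simp)).ShortExact :=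
  (ShortComplex.Splitting.ofHasBinaryBiproduct X Y).shortExact

end Ext

namespace AbelianModelStructure

variable {C : Type u} [Category.{v} C] [Abelian C] [HasExt.{w} C] (M : AbelianModelStructure C)

/-- The model structure is hereditary if both associated cotorsion pairs are. -/
structure IsHereditary : Prop where
  left : HereditaryPair M.cof (M.triv ⊓ M.fib)
  right : HereditaryPair (M.cof ⊓ M.triv) M.fib

/-- The core `ω = 𝒬 ∩ 𝒲 ∩ ℛ`. -/
def core : ObjectProperty C := M.cof ⊓ M.triv ⊓ M.fib

lemma ext_left {X Y : C} (hX : M.cof X) (hY : (M.triv ⊓ M.fib) Y) : Subsingleton (Ext X Y 1) := by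
  rw [M.left_pair.left_eq] at hX
  exact hX Y hY

lemma ext_right {X Y : C} (hX : (M.cof ⊓ M.triv) X) (hY : M.fib Y) :
    Subsingleton (Ext X Y 1) := by
  rw [M.right_pair.right_eq] at hY
  exact hY X hX

lemma cof_ext {S : ShortComplex C} (hS : S.ShortExact) (h₁ : M.cof S.X₁) (h₃ : M.cof S.X₃) :
    M.cof S.X₂ := by
  rw [M.left_pair.left_eq] at *
  exact leftPerp_ext hS h₁ h₃

lemma fib_ext {S : ShortComplex C} (hS : S.ShortExact) (h₁ : M.fib S.X₁) (h₃ : M.fib S.X₃) :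
    M.fib S.X₂ := by
  rw [M.right_pair.right_eq] at *
  exact rightPerp_ext hS h₁ h₃

lemma core_zero : M.core (0 : C) := by
  have h : (M.cof ⊓ M.triv) (0 : C) := by
    rw [M.right_pair.left_eq]; exact leftPerp_zero _
  refine ⟨h, ?_⟩
  rw [M.right_pair.right_eq]; exact rightPerp_zero _

lemma core_biprod {X Y : C} (hX : M.core X) (hY : M.core Y) : M.core (X ⊞ Y) :=
  ⟨⟨M.cof_ext (biprod_shortExact X Y) hX.1.1 hY.1.1,
    M.thick.mem₂ _ (biprod_shortExact X Y) hX.1.2 hY.1.2⟩,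
    M.fib_ext (biprod_shortExact X Y) hX.2 hY.2⟩

/-! ### The homotopy relation and the stable category -/

/-- The morphism `f` factors through an object of the class `P`. -/
def FactorsThrough (P : ObjectProperty C) {A B : C} (f : A ⟶ B) : Prop :=
  ∃ (Z : C) (a : A ⟶ Z) (b : Z ⟶ B), P Z ∧ a ≫ b = f

/-- The (full) homotopy relation: `f ∼ g` if `g - f` factors through an object of the core. -/
def homotopic : HomRel C := fun _ _ f g => FactorsThrough M.core (g - f)

variable {M} in
lemma FactorsThrough.comp {P : ObjectProperty C} {A B D : C} {f : A ⟶ B}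
    (hf : FactorsThrough P f) (g : B ⟶ D) : FactorsThrough P (f ≫ g) := by
  obtain ⟨Z, a, b, hZ, rfl⟩ := hf
  exact ⟨Z, a, b ≫ g, hZ, by simp⟩

lemma FactorsThrough.precomp {P : ObjectProperty C} {A B D : C} {f : A ⟶ B}
    (hf : FactorsThrough P f) (g : D ⟶ A) : FactorsThrough P (g ≫ f) := by
  obtain ⟨Z, a, b, hZ, rfl⟩ := hf
  exact ⟨Z, g ≫ a, b, hZ, by simp⟩

lemma FactorsThrough.neg {P : ObjectProperty C} {A B : C} {f : A ⟶ B}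
    (hf : FactorsThrough P f) : FactorsThrough P (-f) := by
  obtain ⟨Z, a, b, hZ, rfl⟩ := hf
  exact ⟨Z, -a, b, hZ, by simp⟩

lemma factorsThrough_zero (A B : C) : FactorsThrough M.core (0 : A ⟶ B) :=
  ⟨0, 0, 0, M.core_zero, by simp⟩

variable {M} in
lemma FactorsThrough.add {A B : C} {f g : A ⟶ B} (hf : FactorsThrough M.core f)
    (hg : FactorsThrough M.core g) : FactorsThrough M.core (f + g) := by
  obtain ⟨Z, a, b, hZ, rfl⟩ := hf
  obtain ⟨Z', a', b', hZ', rfl⟩ := hg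
  exact ⟨Z ⊞ Z', biprod.lift a a', biprod.desc b b', M.core_biprod hZ hZ', by simp⟩

instance congruence_homotopic : Congruence M.homotopic where
  equivalence :=
    { refl := fun f => by
        simpa [homotopic] using M.factorsThrough_zero _ _
      symm := fun {f g} h => by
        simpa [homotopic] using FactorsThrough.neg h
      trans := fun {f g h} h₁ h₂ => by
        simpa [homotopic] using FactorsThrough.add h₁ h₂ }
  comp_left f _ _ h := by
    simpa [homotopic, Preadditive.comp_sub] using FactorsThrough.precomp h f
  comp_right g h := by
    simpa [homotopic, Preadditive.sub_comp] using FactorsThrough.comp h g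

/-- The stable category `St_ω(𝒜)`: the objects of `𝒜`, with the homotopy classes of morphisms. -/
abbrev St := Quotient M.homotopic

/-- The canonical functor `𝒜 ⥤ St_ω(𝒜)`. -/
abbrev toSt : C ⥤ M.St := Quotient.functor M.homotopic

lemma toSt_map_eq_iff {A B : C} (f g : A ⟶ B) :
    M.toSt.map f = M.toSt.map g ↔ FactorsThrough M.core (g - f) :=
  Quotient.functor_map_eq_iff _ _ _

/-- The group structure on `Hom_ω(A, B)` is induced by that on `Hom(A, B)`. -/
noncomputable instance preadditiveSt : Preadditive M.St :=
  Quotient.preadditive _ fun _ _ f₁ f₂ g₁ g₂ hf hg => by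
    simpa [homotopic, add_sub_add_comm] using FactorsThrough.add hf hg

/-! ### Cofibrant and fibrant replacements -/

/-- A cofibrant replacement sequence `0 ⟶ K ⟶ QA ⟶ A ⟶ 0`: `QA` is cofibrant and `K` is trivially
fibrant. -/
structure CofibrantReplacement (A : C) where
  /-- the kernel -/
  K : C
  /-- the cofibrant replacement -/
  Q : C
  /-- the inclusion of the kernel -/
  i : K ⟶ Q
  /-- the projection -/
  p : Q ⟶ A
  zero : i ≫ p = 0
  shortExact : (ShortComplex.mk i p zero).ShortExact
  cof : M.cof Q
  trivFib : (M.triv ⊓ M.fib) K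

/-- A fibrant replacement sequence `0 ⟶ B ⟶ RB ⟶ L ⟶ 0`: `RB` is fibrant and `L` is trivially
cofibrant. -/
structure FibrantReplacement (B : C) where
  /-- the fibrant replacement -/
  R : C
  /-- the cokernel -/
  L : C
  /-- the inclusion -/
  j : B ⟶ R
  /-- the projection to the cokernel -/
  q : R ⟶ L
  zero : j ≫ q = 0
  shortExact : (ShortComplex.mk j q zero).ShortExact
  fib : M.fib R
  trivCof : (M.cof ⊓ M.triv) L

lemma nonempty_cofibrantReplacement (A : C) : Nonempty (M.CofibrantReplacement A) := by
  obtain ⟨K, Q, i, p, zero, h, hQ, hK⟩ := M.left_pair.enoughProj A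
  exact ⟨⟨K, Q, i, p, zero, h, hQ, hK⟩⟩

lemma nonempty_fibrantReplacement (B : C) : Nonempty (M.FibrantReplacement B) := by
  obtain ⟨R, L, j, q, zero, h, hR, hL⟩ := M.right_pair.enoughInj B
  exact ⟨⟨R, L, j, q, zero, h, hR, hL⟩⟩

/-- A chosen cofibrant replacement of each object. -/
noncomputable def cofRep (A : C) : M.CofibrantReplacement A :=
  (M.nonempty_cofibrantReplacement A).some

/-- A chosen fibrant replacement of each object. -/
noncomputable def fibRep (B : C) : M.FibrantReplacement B :=
  (M.nonempty_fibrantReplacement B).some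

/-- The chosen bifibrant replacement `RQA`: the fibrant replacement of the cofibrant replacement. -/
noncomputable def RQ (A : C) : C := (M.fibRep (M.cofRep A).Q).R

/-- The map `QA ⟶ RQA`. -/
noncomputable def jRQ (A : C) : (M.cofRep A).Q ⟶ M.RQ A := (M.fibRep (M.cofRep A).Q).j

lemma cof_RQ (A : C) : M.cof (M.RQ A) :=
  M.cof_ext (M.fibRep (M.cofRep A).Q).shortExact (M.cofRep A).cof
    (M.fibRep (M.cofRep A).Q).trivCof.1

lemma fib_RQ (A : C) : M.fib (M.RQ A) := (M.fibRep (M.cofRep A).Q).fib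

variable {M} in
/-- A morphism with cofibrant source that factors through a trivially fibrant object factors
through the core. -/
lemma FactorsThrough.core_of_cof {A B : C} (hA : M.cof A) {f : A ⟶ B}
    (hf : FactorsThrough (M.triv ⊓ M.fib) f) : FactorsThrough M.core f := by
  obtain ⟨Z, a, b, hZ, rfl⟩ := hf
  let r := M.cofRep Z
  have := M.ext_left hA r.trivFib
  obtain ⟨g, rfl⟩ := lift_of_ext r.shortExact a
  exact ⟨r.Q, g, r.p ≫ b, ⟨⟨r.cof, M.thick.mem₂ _ r.shortExact r.trivFib.1 hZ.1⟩,
    M.fib_ext r.shortExact r.trivFib.2 hZ.2⟩, by simp⟩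

variable {M} in
/-- A morphism with fibrant target that factors through a trivially cofibrant object factors
through the core. -/
lemma FactorsThrough.core_of_fib {A B : C} (hB : M.fib B) {f : A ⟶ B}
    (hf : FactorsThrough (M.cof ⊓ M.triv) f) : FactorsThrough M.core f := by
  obtain ⟨Z, a, b, hZ, rfl⟩ := hf
  let r := M.fibRep Z
  have := M.ext_right r.trivCof hB
  obtain ⟨g, rfl⟩ := desc_of_ext r.shortExact b
  exact ⟨r.R, a ≫ r.j, g, ⟨⟨M.cof_ext r.shortExact hZ.1 r.trivCof.1,
    M.thick.mem₂ _ r.shortExact hZ.2 r.trivCof.2⟩, r.fib⟩, by simp⟩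

/-! ### The homotopy category -/

/-- `g : RQA ⟶ RQB` is a lift of `f : A ⟶ B`: there is `Q(f) : QA ⟶ QB` over `f`, and `g`
extends `Q(f)`. -/
def IsRQLift {A B : C} (f : A ⟶ B) (g : M.RQ A ⟶ M.RQ B) : Prop :=
  ∃ k : (M.cofRep A).Q ⟶ (M.cofRep B).Q,
    k ≫ (M.cofRep B).p = (M.cofRep A).p ≫ f ∧ M.jRQ A ≫ g = k ≫ M.jRQ B

lemma exists_isRQLift {A B : C} (f : A ⟶ B) : ∃ g, M.IsRQLift f g := by
  have := M.ext_left (M.cofRep A).cof (M.cofRep B).trivFib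
  obtain ⟨k, hk⟩ := lift_of_ext (M.cofRep B).shortExact ((M.cofRep A).p ≫ f)
  have := M.ext_right (M.fibRep (M.cofRep A).Q).trivCof (M.fib_RQ B)
  obtain ⟨g, hg⟩ := desc_of_ext (M.fibRep (M.cofRep A).Q).shortExact (k ≫ M.jRQ B)
  exact ⟨g, k, hk, hg⟩

variable {M} in
lemma IsRQLift.toSt_map_eq {A B : C} {f : A ⟶ B} {g g' : M.RQ A ⟶ M.RQ B}
    (h : M.IsRQLift f g) (h' : M.IsRQLift f g') : M.toSt.map g = M.toSt.map g' := by
  obtain ⟨k, hk, hg⟩ := h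
  obtain ⟨k', hk', hg'⟩ := h'
  rw [toSt_map_eq_iff]
  let r := M.fibRep (M.cofRep A).Q
  have h₁ : FactorsThrough M.core (k' - k) := by
    have h0 : (k' - k) ≫ (M.cofRep B).p = 0 := by simp [hk, hk']
    have := (M.cofRep B).shortExact.mono_f
    exact FactorsThrough.core_of_cof (M.cofRep A).cof
      ⟨_, (M.cofRep B).shortExact.exact.lift (k' - k) h0, (M.cofRep B).i,
        (M.cofRep B).trivFib, (M.cofRep B).shortExact.exact.lift_f _ _⟩
  obtain ⟨Z, a, b, hZ, hab⟩ := h₁.comp (M.jRQ B)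
  have := M.ext_right r.trivCof hZ.2
  obtain ⟨c, hc⟩ : ∃ c : M.RQ A ⟶ Z, M.jRQ A ≫ c = a := desc_of_ext r.shortExact a
  have h0 : M.jRQ A ≫ (g' - g - c ≫ b) = 0 := by
    rw [Preadditive.comp_sub, Preadditive.comp_sub, hg, hg', reassoc_of% hc, hab,
      Preadditive.sub_comp, sub_self]
  have := r.shortExact.epi_g
  have h₂ : FactorsThrough M.core (g' - g - c ≫ b) :=
    FactorsThrough.core_of_fib (M.fib_RQ B)
      ⟨_, r.q, r.shortExact.exact.desc _ h0, r.trivCof, r.shortExact.exact.g_desc _ _⟩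
  simpa using h₂.add (⟨Z, c, b, hZ, rfl⟩ : FactorsThrough M.core (c ≫ b))

lemma isRQLift_id (A : C) : M.IsRQLift (𝟙 A) (𝟙 _) := ⟨𝟙 _, by simp, by simp⟩

variable {M} in
lemma IsRQLift.comp {A B D : C} {f : A ⟶ B} {f' : B ⟶ D} {g : M.RQ A ⟶ M.RQ B}
    {g' : M.RQ B ⟶ M.RQ D} (h : M.IsRQLift f g) (h' : M.IsRQLift f' g') :
    M.IsRQLift (f ≫ f') (g ≫ g') := by
  obtain ⟨k, hk, hg⟩ := h
  obtain ⟨k', hk', hg'⟩ := h'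
  exact ⟨k ≫ k', by simp [hk', reassoc_of% hk], by simp [hg', reassoc_of% hg]⟩

/-- The objects of the homotopy category: those of `𝒜`. -/
structure Ho (_ : AbelianModelStructure C) where
  /-- the underlying object of `𝒜` -/
  of : C

/-- The homotopy category: `Ho(A, B) = Hom_ω(RQA, RQB)`. -/
noncomputable instance categoryHo : Category M.Ho where
  Hom X Y := M.toSt.obj (M.RQ X.of) ⟶ M.toSt.obj (M.RQ Y.of)
  id X := 𝟙 (M.toSt.obj (M.RQ X.of))
  comp f g := CategoryStruct.comp (obj := M.St) f g
  id_comp f := Category.id_comp (obj := M.St) f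
  comp_id f := Category.comp_id (obj := M.St) f
  assoc f g h := Category.assoc (obj := M.St) f g h

noncomputable instance preadditiveHo : Preadditive M.Ho where
  homGroup X Y := inferInstanceAs
    (AddCommGroup (M.toSt.obj (M.RQ X.of) ⟶ M.toSt.obj (M.RQ Y.of)))
  add_comp _ _ _ f f' g := Preadditive.add_comp (C := M.St) _ _ _ f f' g
  comp_add _ _ _ f g g' := Preadditive.comp_add (C := M.St) _ _ _ f g g'

/-- The canonical functor `γ : 𝒜 ⥤ Ho(ℳ)`, the identity on objects, with `γ(f) = [R(Q(f))]`. -/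
noncomputable def γ : C ⥤ M.Ho where
  obj A := ⟨A⟩
  map f := M.toSt.map (M.exists_isRQLift f).choose
  map_id A := ((M.exists_isRQLift (𝟙 A)).choose_spec.toSt_map_eq (M.isRQLift_id A)).trans
    (M.toSt.map_id _)
  map_comp f g := ((M.exists_isRQLift (f ≫ g)).choose_spec.toSt_map_eq
    ((M.exists_isRQLift f).choose_spec.comp (M.exists_isRQLift g).choose_spec)).trans
    (M.toSt.map_comp _ _)

/-! ### Suspensions and loops -/

/-- A cofibrant suspension of `X`: a short exact sequence `0 ⟶ X ⟶ W ⟶ ΣX ⟶ 0` with `W` trivial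
and `ΣX` cofibrant. -/
structure CofibrantSuspension (X : C) where
  /-- the middle term -/
  W : C
  /-- the suspension `ΣX` -/
  S : C
  /-- the inclusion -/
  ι : X ⟶ W
  /-- the projection -/
  π : W ⟶ S
  zero : ι ≫ π = 0
  shortExact : (ShortComplex.mk ι π zero).ShortExact
  triv : M.triv W
  cof : M.cof S

/-- A fibrant loop object of `Y`: a short exact sequence `0 ⟶ ΩY ⟶ W ⟶ Y ⟶ 0` with `W` trivial
and `ΩY` fibrant. -/
structure FibrantLoop (Y : C) where
  /-- the loop object `ΩY` -/
  O : C
  /-- the middle term -/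
  W : C
  /-- the inclusion -/
  ι : O ⟶ W
  /-- the projection -/
  π : W ⟶ Y
  zero : ι ≫ π = 0
  shortExact : (ShortComplex.mk ι π zero).ShortExact
  triv : M.triv W
  fib : M.fib O

variable {M}

/-- `h : ΣX ⟶ ΣX'` is a suspension of `f : X ⟶ X'`: the maps `f` and `h` are the outer maps of a
morphism between the two short exact sequences. -/
def IsSuspensionOf {X X' : C} (s : M.CofibrantSuspension X) (s' : M.CofibrantSuspension X')
    (f : X ⟶ X') (h : s.S ⟶ s'.S) : Prop :=
  ∃ g : s.W ⟶ s'.W, s.ι ≫ g = f ≫ s'.ι ∧ s.π ≫ h = g ≫ s'.π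

/-- `h : ΩY ⟶ ΩY'` is a loop of `f : Y ⟶ Y'`: the maps `h` and `f` are the outer maps of a
morphism between the two short exact sequences. -/
def IsLoopOf {Y Y' : C} (l : M.FibrantLoop Y) (l' : M.FibrantLoop Y')
    (f : Y ⟶ Y') (h : l.O ⟶ l'.O) : Prop :=
  ∃ g : l.W ⟶ l'.W, l.ι ≫ g = h ≫ l'.ι ∧ l.π ≫ f = g ≫ l'.π

/-- `f : QA ⟶ QA'` represents `α : A ⟶ A'` of the homotopy category. (If `α = γ(a)`, then every
`f` over `a` represents it.) -/
def CofibrantReplacement.Represents {A A' : C} (q : M.CofibrantReplacement A)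
    (q' : M.CofibrantReplacement A') (f : q.Q ⟶ q'.Q) (α : M.γ.obj A ⟶ M.γ.obj A') : Prop :=
  M.γ.map f ≫ M.γ.map q'.p = M.γ.map q.p ≫ α

/-- `t : RB ⟶ RB'` represents `β : B ⟶ B'` of the homotopy category. (If `β = γ(b)`, then every
`t` under `b` represents it.) -/
def FibrantReplacement.Represents {B B' : C} (r : M.FibrantReplacement B)
    (r' : M.FibrantReplacement B') (t : r.R ⟶ r'.R) (β : M.γ.obj B ⟶ M.γ.obj B') : Prop :=
  M.γ.map r.j ≫ M.γ.map t = β ≫ M.γ.map r'.j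

end AbelianModelStructure

end HoveyModel

/-! All three groups are quotients of `Hom(QA, RB)` by one subgroup, the maps that factor through
the core ω.

For the left Ext group, the quotient map is the connecting map of `0 → QA → W → ΣQA → 0`. As an
extension of cofibrant objects, `W` is trivially cofibrant, so `Ext¹(W, RB) = 0` and the map is
onto. Its kernel consists of the maps that factor through `QA → W`; since `RB` is fibrant, these
factor through ω. Conversely `Ext¹(ΣQA, Z) = 0` for `Z` in ω. The loop sequence is dual.

For `Ho(A, B)`, the quotient map is `u ↦ γ(p)⁻¹ γ(u) γ(j)⁻¹` (`toHo`). It rests on two facts: on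
maps from a cofibrant to a fibrant object, γ is onto with kernel the maps through ω
(`γ_map_surjective`, `γ_map_eq_zero_iff`); and replacements become isomorphisms in the homotopy
category. Heredity enters in the second fact, for a fibrant replacement of an arbitrary object.

Naturality is then checked on representatives `u : QA ⟶ RB`, where it is naturality of the extension
class. -/

namespace HoveyModel

namespace AbelianModelStructure

variable {C : Type u} [Category.{v} C] [Abelian C] [HasExt.{w} C] {M : AbelianModelStructure C}

/-! ### Calculations in the stable category -/

lemma toSt_map_eq_zero_iff {A B : C} (f : A ⟶ B) :
    M.toSt.map f = M.toSt.map 0 ↔ FactorsThrough M.core f := by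
  rw [eq_comm, toSt_map_eq_iff, sub_zero]

lemma toSt_map_comp_congr {A B D : C} {f f' : A ⟶ B} {g g' : B ⟶ D}
    (hf : M.toSt.map f = M.toSt.map f') (hg : M.toSt.map g = M.toSt.map g') :
    M.toSt.map (f ≫ g) = M.toSt.map (f' ≫ g') := by
  rw [Functor.map_comp, Functor.map_comp, hf, hg]

/-- Stably, a map to a fibrant object is determined by its restriction along a fibrant
replacement. -/
lemma FibrantReplacement.toSt_map_eq {A Y : C} (r : M.FibrantReplacement A) (hY : M.fib Y)
    {u v : r.R ⟶ Y} (h : M.toSt.map (r.j ≫ u) = M.toSt.map (r.j ≫ v)) :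
    M.toSt.map u = M.toSt.map v := by
  rw [toSt_map_eq_iff] at h ⊢
  obtain ⟨Z, a, b, hZ, hab⟩ := h
  -- The factorization through the core extends along `r.j`. What remains of `v - u` vanishes on
  -- `A`, hence factors through the trivially cofibrant cokernel.
  have := M.ext_right r.trivCof hZ.2
  obtain ⟨c, hc⟩ : ∃ c : r.R ⟶ Z, r.j ≫ c = a := desc_of_ext r.shortExact a
  have h0 : r.j ≫ (v - u - c ≫ b) = 0 := by
    rw [Preadditive.comp_sub, Preadditive.comp_sub, reassoc_of% hc, hab, sub_self]
  have := r.shortExact.epi_g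
  have h₂ : FactorsThrough M.core (v - u - c ≫ b) :=
    FactorsThrough.core_of_fib hY
      ⟨_, r.q, r.shortExact.exact.desc _ h0, r.trivCof, r.shortExact.exact.g_desc _ _⟩
  simpa using h₂.add (⟨Z, c, b, hZ, rfl⟩ : FactorsThrough M.core (c ≫ b))

/-- Stably, a map from a cofibrant object to a cofibrant replacement is determined by its
projection. -/
lemma CofibrantReplacement.toSt_map_eq {A X : C} (q : M.CofibrantReplacement A) (hX : M.cof X)
    {u v : X ⟶ q.Q} (h : u ≫ q.p = v ≫ q.p) : M.toSt.map u = M.toSt.map v := by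
  rw [toSt_map_eq_iff]
  have h0 : (v - u) ≫ q.p = 0 := by simp [h]
  have := q.shortExact.mono_f
  exact FactorsThrough.core_of_cof hX
    ⟨_, q.shortExact.exact.lift _ h0, q.i, q.trivFib, q.shortExact.exact.lift_f _ _⟩

/-- The projection of a cofibrant replacement has the lifting property for cofibrant objects. -/
lemma CofibrantReplacement.exists_lift {A X : C} (q : M.CofibrantReplacement A) (hX : M.cof X)
    (f : X ⟶ A) : ∃ g : X ⟶ q.Q, g ≫ q.p = f := by
  have := M.ext_left hX q.trivFib
  exact lift_of_ext q.shortExact f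

/-- The inclusion of a fibrant replacement has the extension property for fibrant objects. -/
lemma FibrantReplacement.exists_desc {A Y : C} (r : M.FibrantReplacement A) (hY : M.fib Y)
    (f : A ⟶ Y) : ∃ g : r.R ⟶ Y, r.j ≫ g = f := by
  have := M.ext_right r.trivCof hY
  exact desc_of_ext r.shortExact f

/-- For cofibrant `X` the projection is already an isomorphism in the stable category: `q.p ≫ σ` and
the identity agree after `q.p`. -/
lemma CofibrantReplacement.exists_section {X : C} (q : M.CofibrantReplacement X)
    (hX : M.cof X) : ∃ σ : X ⟶ q.Q, σ ≫ q.p = 𝟙 X ∧ M.toSt.map (q.p ≫ σ) = M.toSt.map (𝟙 _) := by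
  obtain ⟨σ, hσ⟩ := q.exists_lift hX (𝟙 X)
  exact ⟨σ, hσ, q.toSt_map_eq q.cof (by simp [hσ])⟩

lemma FibrantReplacement.exists_retraction {Y : C} (r : M.FibrantReplacement Y)
    (hY : M.fib Y) : ∃ ρ : r.R ⟶ Y, r.j ≫ ρ = 𝟙 Y ∧ M.toSt.map (ρ ≫ r.j) = M.toSt.map (𝟙 _) := by
  obtain ⟨ρ, hρ⟩ := r.exists_desc hY (𝟙 Y)
  exact ⟨ρ, hρ, r.toSt_map_eq r.fib (by simp [reassoc_of% hρ])⟩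

lemma CofibrantReplacement.fib_Q {Y : C} (q : M.CofibrantReplacement Y) (hY : M.fib Y) :
    M.fib q.Q := M.fib_ext q.shortExact q.trivFib.2 hY

lemma FibrantReplacement.cof_R {X : C} (r : M.FibrantReplacement X) (hX : M.cof X) :
    M.cof r.R := M.cof_ext r.shortExact hX r.trivCof.1

variable (M) in
lemma exists_jRQ_desc {A Y : C} (hY : M.fib Y) (f : (M.cofRep A).Q ⟶ Y) :
    ∃ g : M.RQ A ⟶ Y, M.jRQ A ≫ g = f :=
  (M.fibRep (M.cofRep A).Q).exists_desc hY f

lemma toSt_map_eq_of_jRQ {A Y : C} (hY : M.fib Y) {u v : M.RQ A ⟶ Y}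
    (h : M.toSt.map (M.jRQ A ≫ u) = M.toSt.map (M.jRQ A ≫ v)) : M.toSt.map u = M.toSt.map v :=
  (M.fibRep (M.cofRep A).Q).toSt_map_eq hY h

/-! ### Morphisms of the homotopy category -/

variable (M) in
/-- The morphism of the homotopy category given by a morphism of bifibrant replacements. -/
noncomputable def hoMk {A B : C} (g : M.RQ A ⟶ M.RQ B) : M.γ.obj A ⟶ M.γ.obj B :=
  M.toSt.map g

lemma hoMk_eq_iff {A B : C} {g g' : M.RQ A ⟶ M.RQ B} :
    M.hoMk g = M.hoMk g' ↔ M.toSt.map g = M.toSt.map g' := Iff.rfl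

lemma hoMk_comp {A B D : C} (g : M.RQ A ⟶ M.RQ B) (g' : M.RQ B ⟶ M.RQ D) :
    M.hoMk (g ≫ g') = M.hoMk g ≫ M.hoMk g' := M.toSt.map_comp g g'

lemma hoMk_id (A : C) : M.hoMk (𝟙 (M.RQ A)) = 𝟙 (M.γ.obj A) := M.toSt.map_id _

lemma hoMk_add {A B : C} (g g' : M.RQ A ⟶ M.RQ B) :
    M.hoMk (g + g') = M.hoMk g + M.hoMk g' := rfl

lemma hoMk_zero (A B : C) : M.hoMk (0 : M.RQ A ⟶ M.RQ B) = 0 := by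
  simpa using M.hoMk_add (0 : M.RQ A ⟶ M.RQ B) 0

lemma hoMk_surjective {A B : C} (α : M.γ.obj A ⟶ M.γ.obj B) :
    ∃ g : M.RQ A ⟶ M.RQ B, M.hoMk g = α := Quot.exists_rep α

lemma IsRQLift.γ_map {A B : C} {f : A ⟶ B} {g : M.RQ A ⟶ M.RQ B} (h : M.IsRQLift f g) :
    M.γ.map f = M.hoMk g :=
  (M.exists_isRQLift f).choose_spec.toSt_map_eq h

lemma IsRQLift.add {A B : C} {f f' : A ⟶ B} {g g' : M.RQ A ⟶ M.RQ B}
    (h : M.IsRQLift f g) (h' : M.IsRQLift f' g') : M.IsRQLift (f + f') (g + g') := by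
  obtain ⟨k, hk, hg⟩ := h
  obtain ⟨k', hk', hg'⟩ := h'
  exact ⟨k + k', by simp [hk, hk'], by simp [hg, hg']⟩

/-- The canonical functor is additive. -/
instance γ_additive : M.γ.Additive where
  map_add {A B f f'} := by
    obtain ⟨g, h⟩ := M.exists_isRQLift f
    obtain ⟨g', h'⟩ := M.exists_isRQLift f'
    rw [(h.add h').γ_map, h.γ_map, h'.γ_map, hoMk_add]

lemma triv_RQ {Z : C} (hZ : M.triv Z) : M.triv (M.RQ Z) :=
  M.thick.mem₂ _ (M.fibRep (M.cofRep Z).Q).shortExact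
    (M.thick.mem₂ _ (M.cofRep Z).shortExact (M.cofRep Z).trivFib.1 hZ)
    (M.fibRep (M.cofRep Z).Q).trivCof.2

/-- The bifibrant replacement of a trivial object is again trivial, so it lies in the core and its
identity is stably zero. -/
lemma γ_map_eq_zero_of_triv {A B : C} {f : A ⟶ B} (hf : FactorsThrough M.triv f) :
    M.γ.map f = 0 := by
  obtain ⟨Z, a, b, hZ, rfl⟩ := hf
  have h : 𝟙 (M.γ.obj Z) = 0 := by
    rw [← hoMk_id, ← hoMk_zero, hoMk_eq_iff, toSt_map_eq_zero_iff]
    exact ⟨_, 𝟙 _, 𝟙 _, ⟨⟨M.cof_RQ Z, triv_RQ hZ⟩, M.fib_RQ Z⟩, by simp⟩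
  rw [Functor.map_comp, ← Category.id_comp (M.γ.map b), h, zero_comp, comp_zero]

lemma γ_map_eq_of_toSt_map_eq {A B : C} {f g : A ⟶ B} (h : M.toSt.map f = M.toSt.map g) :
    M.γ.map f = M.γ.map g := by
  obtain ⟨Z, a, b, hZ, hab⟩ := (toSt_map_eq_iff M f g).1 h
  have := γ_map_eq_zero_of_triv (M := M) (f := g - f) ⟨Z, a, b, hZ.1.2, hab⟩
  rw [Functor.map_sub, sub_eq_zero] at this
  exact this.symm

/-- On maps from a cofibrant to a fibrant object, the canonical functor identifies exactly the
maps that factor through the core with zero. -/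
lemma γ_map_eq_zero_iff {X Y : C} (hX : M.cof X) (hY : M.fib Y) (f : X ⟶ Y) :
    M.γ.map f = 0 ↔ FactorsThrough M.core f := by
  refine ⟨fun h => ?_, fun ⟨Z, a, b, hZ, hab⟩ => γ_map_eq_zero_of_triv ⟨Z, a, b, hZ.1.2, hab⟩⟩
  obtain ⟨g, hg⟩ := M.exists_isRQLift f
  rw [hg.γ_map, ← hoMk_zero, hoMk_eq_iff, toSt_map_eq_zero_iff] at h
  obtain ⟨k, hk, hjg⟩ := hg
  obtain ⟨σ, hσ, -⟩ := (M.cofRep X).exists_section hX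
  obtain ⟨ρ, hρ⟩ : ∃ ρ, M.jRQ Y ≫ ρ = 𝟙 _ :=
    (M.fibRep (M.cofRep Y).Q).exists_desc ((M.cofRep Y).fib_Q hY) (𝟙 _)
  -- A section on the cofibrant side and a retraction on the fibrant side recover `f` from its lift
  -- `g`.
  have : f = σ ≫ M.jRQ X ≫ g ≫ ρ ≫ (M.cofRep Y).p := by
    rw [reassoc_of% hjg, reassoc_of% hρ, hk, reassoc_of% hσ]
  rw [this]
  exact ((h.comp _).precomp _).precomp _

/-- Every morphism of the homotopy category from a cofibrant to a fibrant object is represented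
by a morphism of the abelian category. -/
lemma γ_map_surjective {X Y : C} (hX : M.cof X) (hY : M.fib Y) :
    Function.Surjective (M.γ.map : (X ⟶ Y) → _) := by
  intro α
  obtain ⟨g, rfl⟩ := hoMk_surjective α
  obtain ⟨σ, hσ, hσ'⟩ := (M.cofRep X).exists_section hX
  obtain ⟨ρ, hρ, hρ'⟩ : ∃ ρ : M.RQ Y ⟶ _, M.jRQ Y ≫ ρ = 𝟙 _ ∧
      M.toSt.map (ρ ≫ M.jRQ Y) = M.toSt.map (𝟙 _) :=
    (M.fibRep (M.cofRep Y).Q).exists_retraction ((M.cofRep Y).fib_Q hY)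
  -- `g'` is a lift of the candidate preimage; it agrees with `g` stably because `(M.cofRep X).p ≫
  -- σ` and `ρ ≫ M.jRQ Y` are stably identities.
  obtain ⟨g', hg'⟩ := M.exists_jRQ_desc (M.fib_RQ Y)
    (((M.cofRep X).p ≫ σ ≫ M.jRQ X ≫ g ≫ ρ) ≫ M.jRQ Y)
  refine ⟨σ ≫ M.jRQ X ≫ g ≫ ρ ≫ (M.cofRep Y).p, ?_⟩
  rw [IsRQLift.γ_map (g := g') ⟨(M.cofRep X).p ≫ σ ≫ M.jRQ X ≫ g ≫ ρ,
    by simp only [Category.assoc], hg'⟩, hoMk_eq_iff]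
  refine toSt_map_eq_of_jRQ (M.fib_RQ Y) ?_
  rw [hg']
  have := toSt_map_comp_congr hσ' (toSt_map_comp_congr (f := M.jRQ X ≫ g) rfl hρ')
  simpa only [Category.assoc, Category.comp_id, Category.id_comp] using this

/-! ### Replacements are isomorphisms in the homotopy category -/

lemma isIso_γ_map_cofRep (A : C) : IsIso (M.γ.map (M.cofRep A).p) := by
  set q := M.cofRep A
  set q₂ := M.cofRep q.Q
  obtain ⟨σ, hσ, hσ'⟩ := q₂.exists_section q.cof
  obtain ⟨g, hg⟩ := M.exists_jRQ_desc (A := q.Q) (M.fib_RQ A) (q₂.p ≫ M.jRQ A)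
  obtain ⟨h, hh⟩ := M.exists_jRQ_desc (A := A) (M.fib_RQ q.Q) (σ ≫ M.jRQ q.Q)
  -- The map `q₂.p` itself serves as `Q(q.p)`, and its stable inverse σ induces the inverse `h`.
  rw [IsRQLift.γ_map (f := q.p) (g := g) ⟨q₂.p, rfl, hg⟩]
  refine ⟨M.hoMk h, ?_, ?_⟩
  · rw [← hoMk_comp, ← hoMk_id, hoMk_eq_iff]
    refine toSt_map_eq_of_jRQ (M.fib_RQ _) ?_
    rw [reassoc_of% hg, hh]
    simpa using toSt_map_comp_congr hσ' (g := M.jRQ q.Q) rfl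
  · rw [← hoMk_comp, ← hoMk_id, hoMk_eq_iff]
    refine toSt_map_eq_of_jRQ (M.fib_RQ _) ?_
    rw [reassoc_of% hh, hg, reassoc_of% hσ, Category.comp_id]

/-- A cofibrant replacement is an isomorphism in the homotopy category. -/
instance CofibrantReplacement.isIso_γ_map {A : C} (q : M.CofibrantReplacement A) :
    IsIso (M.γ.map q.p) := by
  have := M.isIso_γ_map_cofRep A
  -- Two cofibrant replacements lift to each other, and the lifts are stably inverse; this reduces
  -- the claim to the chosen replacement.
  obtain ⟨a, ha⟩ := q.exists_lift (M.cofRep A).cof (M.cofRep A).p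
  obtain ⟨b, hb⟩ := (M.cofRep A).exists_lift q.cof q.p
  have : IsIso (M.γ.map b) := by
    refine ⟨M.γ.map a, ?_, ?_⟩
    · rw [← Functor.map_comp, ← M.γ.map_id]
      exact γ_map_eq_of_toSt_map_eq (q.toSt_map_eq q.cof (by simp [ha, hb]))
    · rw [← Functor.map_comp, ← M.γ.map_id]
      exact γ_map_eq_of_toSt_map_eq ((M.cofRep A).toSt_map_eq (M.cofRep A).cof (by simp [ha, hb]))
  rw [← hb, Functor.map_comp]
  infer_instance

lemma FibrantReplacement.isIso_γ_map_of_cof {X : C} (r : M.FibrantReplacement X)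
    (hX : M.cof X) : IsIso (M.γ.map r.j) := by
  set qX := M.cofRep X
  set qR := M.cofRep r.R
  obtain ⟨σ, hσ, hσ'⟩ := qX.exists_section hX
  obtain ⟨τ, hτ, hτ'⟩ := qR.exists_section (r.cof_R hX)
  obtain ⟨k, hk⟩ := qR.exists_lift qX.cof (qX.p ≫ r.j)
  obtain ⟨g, hg⟩ := M.exists_jRQ_desc (A := X) (M.fib_RQ r.R) (k ≫ M.jRQ r.R)
  -- The inverse is built by extending σ over `r.R`, then passing to the bifibrant replacement of
  -- `r.R`.
  obtain ⟨x, hx⟩ := r.exists_desc (M.fib_RQ X) (σ ≫ M.jRQ X)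
  obtain ⟨h, hh⟩ := M.exists_jRQ_desc (A := r.R) (M.fib_RQ X) (qR.p ≫ x)
  rw [IsRQLift.γ_map (f := r.j) (g := g) ⟨k, hk, hg⟩]
  refine ⟨M.hoMk h, ?_, ?_⟩
  · rw [← hoMk_comp, ← hoMk_id, hoMk_eq_iff]
    refine toSt_map_eq_of_jRQ (M.fib_RQ _) ?_
    rw [reassoc_of% hg, hh, reassoc_of% hk, hx]
    simpa using toSt_map_comp_congr hσ' (g := M.jRQ X) rfl
  · rw [← hoMk_comp, ← hoMk_id, hoMk_eq_iff]
    have h₁ : M.toSt.map (σ ≫ k) = M.toSt.map (r.j ≫ τ) :=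
      qR.toSt_map_eq hX (by simp [hk, hτ, reassoc_of% hσ])
    have h₂ : M.toSt.map (x ≫ g) = M.toSt.map (τ ≫ M.jRQ r.R) := by
      refine r.toSt_map_eq (M.fib_RQ _) ?_
      rw [reassoc_of% hx, hg]
      simpa using toSt_map_comp_congr h₁ (g := M.jRQ r.R) rfl
    refine toSt_map_eq_of_jRQ (M.fib_RQ _) ?_
    rw [reassoc_of% hh]
    refine (toSt_map_comp_congr (f := qR.p) rfl h₂).trans ?_
    simpa using toSt_map_comp_congr hτ' (g := M.jRQ r.R) rfl

/-- In a hereditary model structure the cofibrant objects are closed under kernels of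
epimorphisms. -/
lemma IsHereditary.cof_kernel (hM : M.IsHereditary) {S : ShortComplex C} (hS : S.ShortExact)
    (h₂ : M.cof S.X₂) (h₃ : M.cof S.X₃) : M.cof S.X₁ := by
  rw [M.left_pair.left_eq]
  intro Y hY
  have := M.ext_left h₂ hY
  -- Heredity is needed in degree 2: `Ext¹(X₁, Y)` sits between `Ext¹(X₂, Y)` and `Ext²(X₃, Y)`.
  have := hM.left _ _ h₃ hY 2 (by norm_num)
  refine subsingleton_of_forall_eq 0 fun e => ?_
  obtain ⟨x, rfl⟩ := Ext.contravariant_sequence_exact₁ hS Y e (n₁ := 2) rfl (Subsingleton.elim _ _)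
  rw [Subsingleton.elim x 0, Ext.comp_zero]

/-- A fibrant replacement is an isomorphism in the homotopy category. -/
lemma FibrantReplacement.isIso_γ_map (hM : M.IsHereditary) {B : C} (r : M.FibrantReplacement B) :
    IsIso (M.γ.map r.j) := by
  set q := M.cofRep r.R
  have : Mono q.i := q.shortExact.mono_f
  have : Epi q.p := q.shortExact.epi_g
  have : Mono r.j := r.shortExact.mono_f
  have : Epi r.q := r.shortExact.epi_g
  -- Let `P` be the pullback of `r.j` and `q.p`. The map `P → B` inherits the kernel of `q.p`, and
  -- `P → q.Q` inherits the cokernel of `r.j`.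
  have w₁ : pullback.lift (f := r.j) (g := q.p) 0 q.i (by simp [q.zero]) ≫
      pullback.fst _ _ = 0 :=
    pullback.lift_fst _ _ _
  have m₁ : Mono (pullback.lift (f := r.j) (g := q.p) 0 q.i (by simp [q.zero])) :=
    mono_of_mono_fac (pullback.lift_snd _ _ _)
  have S₁ : (ShortComplex.mk _ _ w₁).ShortExact :=
    { exact := ShortComplex.exact_of_f_is_kernel _ <| KernelFork.IsLimit.ofι' _ _ fun k hk =>
        ⟨q.shortExact.exact.lift (k ≫ pullback.snd _ _) (by
          dsimp only at hk ⊢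
          rw [Category.assoc, ← pullback.condition, reassoc_of% hk, zero_comp]), by
          apply pullback.hom_ext
          · simpa only [Category.assoc, pullback.lift_fst, comp_zero] using hk.symm
          · simpa only [Category.assoc, pullback.lift_snd] using q.shortExact.exact.lift_f _ _⟩
      mono_f := m₁
      epi_g := by dsimp only; infer_instance }
  have w₂ : pullback.snd r.j q.p ≫ q.p ≫ r.q = 0 := by
    rw [← pullback.condition_assoc, r.zero, comp_zero]
  have S₂ : (ShortComplex.mk _ _ w₂).ShortExact :=
    { exact := ShortComplex.exact_of_f_is_kernel _ <| KernelFork.IsLimit.ofι' _ _ fun k hk =>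
        ⟨pullback.lift (r.shortExact.exact.lift (k ≫ q.p) (by simpa using hk)) k
          (r.shortExact.exact.lift_f _ _), pullback.lift_snd _ _ _⟩
      mono_f := by dsimp only; infer_instance
      epi_g := by dsimp only; exact epi_comp _ _ }
  -- Hence `P → B` is a cofibrant replacement, and `P → q.Q` is a fibrant replacement of a cofibrant
  -- object. Three sides of the pullback square are thus inverted by γ, which forces the fourth,
  -- `r.j`.
  have hP : M.cof (pullback r.j q.p) := hM.cof_kernel S₂ q.cof r.trivCof.1
  let qP : M.CofibrantReplacement B := ⟨_, _, _, _, w₁, S₁, hP, q.trivFib⟩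
  let rP : M.FibrantReplacement (pullback r.j q.p) :=
    ⟨_, _, _, _, w₂, S₂, q.fib_Q r.fib, r.trivCof⟩
  have h₁ : IsIso (M.γ.map (pullback.fst r.j q.p)) := qP.isIso_γ_map
  have h₂ : IsIso (M.γ.map (pullback.snd r.j q.p)) := rP.isIso_γ_map_of_cof hP
  have h₃ : IsIso (M.γ.map (pullback.fst r.j q.p) ≫ M.γ.map r.j) := by
    rw [← Functor.map_comp, pullback.condition, Functor.map_comp]
    infer_instance
  exact IsIso.of_isIso_comp_left (M.γ.map (pullback.fst r.j q.p)) _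

end AbelianModelStructure

end HoveyModel

/-! ### The three groups as quotients of `Hom(QA, RB)` -/

namespace HoveyModel

/-- Two surjective homomorphisms with the same kernel have isomorphic targets. -/
lemma exists_addEquiv_of_ker_eq {G H K : Type*} [AddCommGroup G] [AddCommGroup H]
    [AddCommGroup K] (f : G →+ H) (g : G →+ K) (hf : Function.Surjective f)
    (hg : Function.Surjective g) (h : ∀ x, f x = 0 ↔ g x = 0) :
    ∃ e : H ≃+ K, ∀ x, e (f x) = g x := by
  have hker : f.ker = g.ker := by ext x; exact h x
  refine ⟨(QuotientAddGroup.quotientKerEquivOfSurjective f hf).symm.trans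
    ((QuotientAddGroup.quotientAddEquivOfEq hker).trans
      (QuotientAddGroup.quotientKerEquivOfSurjective g hg)), fun x => ?_⟩
  have : (QuotientAddGroup.quotientKerEquivOfSurjective f hf).symm (f x) =
      QuotientAddGroup.mk x := by
    rw [AddEquiv.symm_apply_eq]; rfl
  simp only [AddEquiv.trans_apply, this]
  rfl

namespace AbelianModelStructure

variable {C : Type u} [Category.{v} C] [Abelian C] [HasExt.{w} C] {M : AbelianModelStructure C}

/-! ### The homotopy category and morphisms between replacements -/

/-- The morphism `A ⟶ B` of the homotopy category represented by `QA ⟶ RB`. -/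
noncomputable def toHo (hM : M.IsHereditary) {A B : C} (q : M.CofibrantReplacement A)
    (r : M.FibrantReplacement B) : (q.Q ⟶ r.R) →+ (M.γ.obj A ⟶ M.γ.obj B) :=
  have := r.isIso_γ_map hM
  AddMonoidHom.mk' (fun u => inv (M.γ.map q.p) ≫ M.γ.map u ≫ inv (M.γ.map r.j))
    fun u v => by simp [Functor.map_add]

section

variable (hM : M.IsHereditary) {A B : C} (q : M.CofibrantReplacement A)
  (r : M.FibrantReplacement B)

lemma γ_map_toHo (u : q.Q ⟶ r.R) :
    M.γ.map q.p ≫ toHo hM q r u ≫ M.γ.map r.j = M.γ.map u := by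
  have := r.isIso_γ_map hM
  simp [toHo]

/-- Since `γ(p)` and `γ(j)` are invertible, this equation characterizes `toHo`; surjectivity and
both naturalities follow from it without handling inverses. -/
lemma toHo_eq_of {u : q.Q ⟶ r.R} {α : M.γ.obj A ⟶ M.γ.obj B}
    (h : M.γ.map u = M.γ.map q.p ≫ α ≫ M.γ.map r.j) : toHo hM q r u = α := by
  have := r.isIso_γ_map hM
  rw [← γ_map_toHo hM, cancel_epi, cancel_mono] at h
  exact h

lemma toHo_surjective : Function.Surjective (toHo hM q r) := fun α => by
  obtain ⟨u, hu⟩ := γ_map_surjective q.cof r.fib (M.γ.map q.p ≫ α ≫ M.γ.map r.j)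
  exact ⟨u, toHo_eq_of hM q r hu⟩

lemma toHo_eq_zero_iff (u : q.Q ⟶ r.R) : toHo hM q r u = 0 ↔ FactorsThrough M.core u := by
  rw [← γ_map_eq_zero_iff q.cof r.fib]
  refine ⟨fun h => ?_, fun h => toHo_eq_of hM q r (by simp [h])⟩
  rw [← γ_map_toHo hM q r u, h, zero_comp, comp_zero]

/-- Precomposition with a represented morphism. -/
lemma toHo_precomp {A' : C} {q' : M.CofibrantReplacement A'} {f : q.Q ⟶ q'.Q}
    {α : M.γ.obj A ⟶ M.γ.obj A'} (h : q.Represents q' f α) (u : q'.Q ⟶ r.R) :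
    toHo hM q r (f ≫ u) = α ≫ toHo hM q' r u := by
  apply toHo_eq_of
  rw [Functor.map_comp, ← γ_map_toHo hM q' r u, Category.assoc]
  exact (reassoc_of% h) _

/-- Postcomposition with a represented morphism. -/
lemma toHo_postcomp {B' : C} {r' : M.FibrantReplacement B'} {t : r.R ⟶ r'.R}
    {β : M.γ.obj B ⟶ M.γ.obj B'} (h : r.Represents r' t β) (u : q.Q ⟶ r.R) :
    toHo hM q r' (u ≫ t) = toHo hM q r u ≫ β := by
  apply toHo_eq_of
  rw [Functor.map_comp, ← γ_map_toHo hM q r u, Category.assoc, Category.assoc, Category.assoc, ← h]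

end

/-! ### The connecting homomorphisms -/

/-- The connecting homomorphism `Hom(X, Y) ⟶ Ext¹(ΣX, Y)`. -/
noncomputable def CofibrantSuspension.δ {X : C} (s : M.CofibrantSuspension X) (Y : C) :
    (X ⟶ Y) →+ Ext s.S Y 1 :=
  AddMonoidHom.mk' (fun u => s.shortExact.extClass.comp (Ext.mk₀ u) (add_zero 1))
    fun u v => by rw [Ext.mk₀_add, Ext.comp_add]

lemma CofibrantSuspension.δ_apply {X : C} (s : M.CofibrantSuspension X) {Y : C} (u : X ⟶ Y) :
    s.δ Y u = s.shortExact.extClass.comp (Ext.mk₀ u) (add_zero 1) := rfl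

lemma CofibrantSuspension.trivCof_W {X : C} (s : M.CofibrantSuspension X) (hX : M.cof X) :
    (M.cof ⊓ M.triv) s.W :=
  ⟨M.cof_ext s.shortExact hX s.cof, s.triv⟩

lemma CofibrantSuspension.δ_surjective {X Y : C} (s : M.CofibrantSuspension X) (hX : M.cof X)
    (hY : M.fib Y) : Function.Surjective (s.δ Y) := fun e => by
  have := M.ext_right (s.trivCof_W hX) hY
  obtain ⟨x, hx⟩ := Ext.contravariant_sequence_exact₃ s.shortExact Y e
    (Subsingleton.elim (α := Ext s.W Y 1) _ _) (add_zero 1)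
  obtain ⟨u, rfl⟩ := (Ext.mk₀_bijective X Y).2 x
  exact ⟨u, hx⟩

lemma CofibrantSuspension.δ_eq_zero_iff {X Y : C} (s : M.CofibrantSuspension X) (hX : M.cof X)
    (hY : M.fib Y) (u : X ⟶ Y) : s.δ Y u = 0 ↔ FactorsThrough M.core u := by
  constructor
  · intro h
    obtain ⟨x, hx⟩ := Ext.contravariant_sequence_exact₁ s.shortExact Y (Ext.mk₀ u) (add_zero 1) h
    obtain ⟨g, rfl⟩ := (Ext.mk₀_bijective s.W Y).2 x
    exact FactorsThrough.core_of_fib hY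
      ⟨s.W, s.ι, g, s.trivCof_W hX, (Ext.mk₀_bijective X Y).1 (by simpa using hx)⟩
  · rintro ⟨Z, a, b, hZ, rfl⟩
    -- The class pushed forward along `a` already lies in `Ext¹(ΣX, Z) = 0`, as `Z` is trivially
    -- fibrant.
    have := M.ext_left s.cof ⟨hZ.1.2, hZ.2⟩
    rw [δ_apply, ← Ext.mk₀_comp_mk₀, ← Ext.comp_assoc_of_third_deg_zero,
      Subsingleton.elim (s.shortExact.extClass.comp (Ext.mk₀ a) (add_zero 1)) 0, Ext.zero_comp]

lemma CofibrantSuspension.δ_precomp {X X' Y : C} {s : M.CofibrantSuspension X}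
    {s' : M.CofibrantSuspension X'} {f : X ⟶ X'} {h : s.S ⟶ s'.S} (hf : IsSuspensionOf s s' f h)
    (u : X' ⟶ Y) : (Ext.mk₀ h).comp (s'.δ Y u) (zero_add 1) = s.δ Y (f ≫ u) := by
  obtain ⟨g, h₁, h₂⟩ := hf
  have := ShortComplex.ShortExact.extClass_naturality s.shortExact s'.shortExact
    ⟨f, g, h, h₁.symm, h₂.symm⟩
  dsimp only at this
  rw [δ_apply, δ_apply, ← Ext.mk₀_comp_mk₀, ← Ext.comp_assoc_of_third_deg_zero, ← this,
    Ext.comp_assoc_of_third_deg_zero]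

lemma CofibrantSuspension.δ_postcomp {X Y Y' : C} (s : M.CofibrantSuspension X) (u : X ⟶ Y)
    (t : Y ⟶ Y') : (s.δ Y u).comp (Ext.mk₀ t) (add_zero 1) = s.δ Y' (u ≫ t) := by
  rw [δ_apply, δ_apply, ← Ext.mk₀_comp_mk₀, ← Ext.comp_assoc_of_third_deg_zero]

/-- The connecting homomorphism `Hom(X, Y) ⟶ Ext¹(X, ΩY)`. -/
noncomputable def FibrantLoop.δ {Y : C} (l : M.FibrantLoop Y) (X : C) :
    (X ⟶ Y) →+ Ext X l.O 1 :=
  AddMonoidHom.mk' (fun u => (Ext.mk₀ u).comp l.shortExact.extClass (zero_add 1))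
    fun u v => by rw [Ext.mk₀_add, Ext.add_comp]

lemma FibrantLoop.δ_apply {X Y : C} (l : M.FibrantLoop Y) (u : X ⟶ Y) :
    l.δ X u = (Ext.mk₀ u).comp l.shortExact.extClass (zero_add 1) := rfl

lemma FibrantLoop.trivFib_W {Y : C} (l : M.FibrantLoop Y) (hY : M.fib Y) :
    (M.triv ⊓ M.fib) l.W :=
  ⟨l.triv, M.fib_ext l.shortExact l.fib hY⟩

lemma FibrantLoop.δ_surjective {X Y : C} (l : M.FibrantLoop Y) (hX : M.cof X)
    (hY : M.fib Y) : Function.Surjective (l.δ X) := fun e => by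
  have := M.ext_left hX (l.trivFib_W hY)
  obtain ⟨x, hx⟩ := Ext.covariant_sequence_exact₁ X l.shortExact e
    (Subsingleton.elim (α := Ext X l.W 1) _ _) (zero_add 1)
  obtain ⟨u, rfl⟩ := (Ext.mk₀_bijective X Y).2 x
  exact ⟨u, hx⟩

lemma FibrantLoop.δ_eq_zero_iff {X Y : C} (l : M.FibrantLoop Y) (hX : M.cof X)
    (hY : M.fib Y) (u : X ⟶ Y) : l.δ X u = 0 ↔ FactorsThrough M.core u := by
  constructor
  · intro h
    obtain ⟨x, hx⟩ := Ext.covariant_sequence_exact₃ X l.shortExact (Ext.mk₀ u) (zero_add 1) h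
    obtain ⟨g, rfl⟩ := (Ext.mk₀_bijective X l.W).2 x
    exact FactorsThrough.core_of_cof hX
      ⟨l.W, g, l.π, l.trivFib_W hY, (Ext.mk₀_bijective X Y).1 (by simpa using hx)⟩
  · rintro ⟨Z, a, b, hZ, rfl⟩
    -- Here the loop class pulled back along `b` lies in `Ext¹(Z, ΩY) = 0`, as `Z` is trivially
    -- cofibrant.
    have := M.ext_right hZ.1 l.fib
    rw [δ_apply, ← Ext.mk₀_comp_mk₀, Ext.comp_assoc_of_second_deg_zero,
      Subsingleton.elim ((Ext.mk₀ b).comp l.shortExact.extClass (zero_add 1)) 0, Ext.comp_zero]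

lemma FibrantLoop.δ_postcomp {X Y Y' : C} {l : M.FibrantLoop Y}
    {l' : M.FibrantLoop Y'} {t : Y ⟶ Y'} {h : l.O ⟶ l'.O} (ht : IsLoopOf l l' t h)
    (u : X ⟶ Y) : (l.δ X u).comp (Ext.mk₀ h) (add_zero 1) = l'.δ X (u ≫ t) := by
  obtain ⟨g, h₁, h₂⟩ := ht
  have := ShortComplex.ShortExact.extClass_naturality l.shortExact l'.shortExact
    ⟨h, g, t, h₁.symm, h₂.symm⟩
  dsimp only at this
  rw [δ_apply, δ_apply, ← Ext.mk₀_comp_mk₀, Ext.comp_assoc_of_third_deg_zero, this,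
    Ext.comp_assoc_of_second_deg_zero]

lemma FibrantLoop.δ_precomp {X X' Y : C} (l : M.FibrantLoop Y) (f : X ⟶ X') (u : X' ⟶ Y) :
    (Ext.mk₀ f).comp (l.δ X' u) (zero_add 1) = l.δ X (f ≫ u) := by
  rw [δ_apply, δ_apply, ← Ext.mk₀_comp_mk₀, Ext.comp_assoc_of_second_deg_zero]

/-! ### Existence of suspensions and loops -/

lemma exists_cofibrantSuspension (X : C) : ∃ s : M.CofibrantSuspension X, M.fib s.W := by
  obtain ⟨W, S, j, q, zero, h, hW, hS⟩ := M.left_pair.enoughInj X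
  exact ⟨⟨W, S, j, q, zero, h, hW.1, hS⟩, hW.2⟩

lemma exists_fibrantLoop (Y : C) : ∃ l : M.FibrantLoop Y, M.cof l.W := by
  obtain ⟨O, W, i, p, zero, h, hW, hO⟩ := M.right_pair.enoughProj Y
  exact ⟨⟨O, W, i, p, zero, h, hW.2, hO⟩, hW.1⟩

/-- Fibrancy of the target's middle term gives `Ext¹(ΣX, W') = 0`, so `X ⟶ X' ⟶ W'` extends over
`W`. -/
lemma exists_isSuspensionOf {X X' : C} (s : M.CofibrantSuspension X)
    (s' : M.CofibrantSuspension X') (hs' : M.fib s'.W) (f : X ⟶ X') :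
    ∃ h, IsSuspensionOf s s' f h := by
  have := M.ext_left s.cof ⟨s'.triv, hs'⟩
  obtain ⟨g, hg⟩ := desc_of_ext s.shortExact (f ≫ s'.ι)
  have := s.shortExact.epi_g
  exact ⟨s.shortExact.exact.desc (g ≫ s'.π)
    (by simp [reassoc_of% hg, s'.zero]), g, hg, s.shortExact.exact.g_desc _ _⟩

/-- Dually, a cofibrant middle term in the source gives `Ext¹(W, ΩY') = 0`. -/
lemma exists_isLoopOf {Y Y' : C} (l : M.FibrantLoop Y) (l' : M.FibrantLoop Y') (hl : M.cof l.W)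
    (t : Y ⟶ Y') : ∃ h, IsLoopOf l l' t h := by
  have := M.ext_right ⟨hl, l.triv⟩ l'.fib
  obtain ⟨g, hg⟩ := lift_of_ext l'.shortExact (l.π ≫ t)
  have := l'.shortExact.mono_f
  exact ⟨l'.shortExact.exact.lift (l.ι ≫ g) (by simp [hg, reassoc_of% l.zero]), g,
    (l'.shortExact.exact.lift_f _ _).symm, hg.symm⟩

end AbelianModelStructure

end HoveyModel

/-! ### Assembly of the natural isomorphisms -/

open HoveyModel HoveyModel.AbelianModelStructure in
theorem mainTheorem5 {C : Type u} [Category.{v} C] [Abelian C] [HasExt.{w} C]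
    (M : AbelianModelStructure C) (hM : M.IsHereditary) :
    -- `Ext¹(ΣQA, RB) ≅ Ho(A, B)`, naturally in `A` and in `B`
    (∃ φ : ∀ ⦃A B : C⦄ (q : M.CofibrantReplacement A) (s : M.CofibrantSuspension q.Q)
        (r : M.FibrantReplacement B), Ext s.S r.R 1 ≃+ (M.γ.obj A ⟶ M.γ.obj B),
      (∀ ⦃A A' B : C⦄ (q : M.CofibrantReplacement A) (s : M.CofibrantSuspension q.Q)
        (q' : M.CofibrantReplacement A') (s' : M.CofibrantSuspension q'.Q)
        (r : M.FibrantReplacement B) (α : M.γ.obj A ⟶ M.γ.obj A') (f : q.Q ⟶ q'.Q)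
        (h : s.S ⟶ s'.S), q.Represents q' f α → IsSuspensionOf s s' f h →
        ∀ e : Ext s'.S r.R 1,
          φ q s r ((Ext.mk₀ h).comp e (zero_add 1)) = α ≫ φ q' s' r e) ∧
      (∀ ⦃A B B' : C⦄ (q : M.CofibrantReplacement A) (s : M.CofibrantSuspension q.Q)
        (r : M.FibrantReplacement B) (r' : M.FibrantReplacement B')
        (β : M.γ.obj B ⟶ M.γ.obj B') (t : r.R ⟶ r'.R), r.Represents r' t β →
        ∀ e : Ext s.S r.R 1,
          φ q s r' (e.comp (Ext.mk₀ t) (add_zero 1)) = φ q s r e ≫ β)) ∧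
    -- `Ho(A, B) ≅ Ext¹(QA, ΩRB)`, naturally in `A` and in `B`
    (∃ ψ : ∀ ⦃A B : C⦄ (q : M.CofibrantReplacement A) (r : M.FibrantReplacement B)
        (l : M.FibrantLoop r.R), (M.γ.obj A ⟶ M.γ.obj B) ≃+ Ext q.Q l.O 1,
      (∀ ⦃A A' B : C⦄ (q : M.CofibrantReplacement A) (q' : M.CofibrantReplacement A')
        (r : M.FibrantReplacement B) (l : M.FibrantLoop r.R)
        (α : M.γ.obj A ⟶ M.γ.obj A') (f : q.Q ⟶ q'.Q), q.Represents q' f α →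
        ∀ b : M.γ.obj A' ⟶ M.γ.obj B,
          ψ q r l (α ≫ b) = (Ext.mk₀ f).comp (ψ q' r l b) (zero_add 1)) ∧
      (∀ ⦃A B B' : C⦄ (q : M.CofibrantReplacement A) (r : M.FibrantReplacement B)
        (l : M.FibrantLoop r.R) (r' : M.FibrantReplacement B') (l' : M.FibrantLoop r'.R)
        (β : M.γ.obj B ⟶ M.γ.obj B') (t : r.R ⟶ r'.R) (h : l.O ⟶ l'.O),
        r.Represents r' t β → IsLoopOf l l' t h →
        ∀ b : M.γ.obj A ⟶ M.γ.obj B,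
          ψ q r' l' (b ≫ β) = (ψ q r l b).comp (Ext.mk₀ h) (add_zero 1))) ∧
    -- the objects `QA`, `ΣQA`, `RB`, `ΩRB` exist, and morphisms of `𝒜` lift to them
    (∀ A : C, ∃ (q : M.CofibrantReplacement A) (s : M.CofibrantSuspension q.Q), M.fib s.W) ∧
    (∀ ⦃A A' : C⦄ (a : A ⟶ A') (q : M.CofibrantReplacement A) (s : M.CofibrantSuspension q.Q)
      (q' : M.CofibrantReplacement A') (s' : M.CofibrantSuspension q'.Q), M.fib s'.W →
      ∃ (f : q.Q ⟶ q'.Q) (h : s.S ⟶ s'.S),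
        f ≫ q'.p = q.p ≫ a ∧ IsSuspensionOf s s' f h) ∧
    (∀ B : C, ∃ (r : M.FibrantReplacement B) (l : M.FibrantLoop r.R), M.cof l.W) ∧
    (∀ ⦃B B' : C⦄ (b : B ⟶ B') (r : M.FibrantReplacement B) (l : M.FibrantLoop r.R)
      (r' : M.FibrantReplacement B') (l' : M.FibrantLoop r'.R), M.cof l.W →
      ∃ (t : r.R ⟶ r'.R) (h : l.O ⟶ l'.O),
        r.j ≫ t = b ≫ r'.j ∧ IsLoopOf l l' t h) := by
  refine ⟨?_, ?_, fun A => ?_, fun A A' a q s q' s' hs' => ?_, fun B => ?_,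
    fun B B' b r l r' l' hl => ?_⟩
  -- The equation `φ (δ u) = toHo u` determines φ, since δ is onto. So choosing an isomorphism
  -- separately for each set of data does no harm to naturality.
  · choose φ hφ using fun (A B : C) (q : M.CofibrantReplacement A)
      (s : M.CofibrantSuspension q.Q) (r : M.FibrantReplacement B) =>
      exists_addEquiv_of_ker_eq (s.δ r.R) (toHo hM q r) (s.δ_surjective q.cof r.fib)
        (toHo_surjective hM q r) fun u =>
          (s.δ_eq_zero_iff q.cof r.fib u).trans (toHo_eq_zero_iff hM q r u).symm
    refine ⟨fun A B q s r => φ A B q s r, fun A A' B q s q' s' r α f h hf hh e => ?_,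
      fun A B B' q s r r' β t ht e => ?_⟩
    · obtain ⟨u, rfl⟩ := s'.δ_surjective q'.cof r.fib e
      rw [CofibrantSuspension.δ_precomp hh, hφ, hφ, toHo_precomp hM q r hf]
    · obtain ⟨u, rfl⟩ := s.δ_surjective q.cof r.fib e
      rw [CofibrantSuspension.δ_postcomp, hφ, hφ, toHo_postcomp hM q r ht]
  · choose ψ hψ using fun (A B : C) (q : M.CofibrantReplacement A)
      (r : M.FibrantReplacement B) (l : M.FibrantLoop r.R) =>
      exists_addEquiv_of_ker_eq (toHo hM q r) (l.δ q.Q) (toHo_surjective hM q r)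
        (l.δ_surjective q.cof r.fib) fun u =>
          (toHo_eq_zero_iff hM q r u).trans (l.δ_eq_zero_iff q.cof r.fib u).symm
    refine ⟨fun A B q r l => ψ A B q r l, fun A A' B q q' r l α f hf b => ?_,
      fun A B B' q r l r' l' β t h ht hh b => ?_⟩
    -- Here representatives are taken through `toHo`, because ψ is determined by `ψ (toHo u) = δ u`.
    · obtain ⟨u, rfl⟩ := toHo_surjective hM q' r b
      rw [← toHo_precomp hM q r hf, hψ, hψ, FibrantLoop.δ_precomp]
    · obtain ⟨u, rfl⟩ := toHo_surjective hM q r b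
      rw [← toHo_postcomp hM q r ht, hψ, hψ, FibrantLoop.δ_postcomp hh]
  · obtain ⟨q⟩ := M.nonempty_cofibrantReplacement A
    exact ⟨q, exists_cofibrantSuspension q.Q⟩
  · obtain ⟨f, hf⟩ := q'.exists_lift q.cof (q.p ≫ a)
    obtain ⟨h, hh⟩ := exists_isSuspensionOf s s' hs' f
    exact ⟨f, h, hf, hh⟩
  · obtain ⟨r⟩ := M.nonempty_fibrantReplacement B
    exact ⟨r, exists_fibrantLoop r.R⟩
  · obtain ⟨t, ht⟩ := r.exists_desc r'.fib (b ≫ r'.j)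
    obtain ⟨h, hh⟩ := exists_isLoopOf l l' hl t
    exact ⟨t, h, ht, hh⟩
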